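/- Let $U=\{z\in\mathbb C:|z|<1\}$, let $\overline U$ be the closed unit disc with boundary circle $\mathbb S^1$, and let $\mathbb S^2\cong U\cup\{\infty\}$ be the one-point compactification of $U$. Evaluation at $\infty$ gives an essential $C^*$-algebra extension $0\to C_0(U)\to C(\mathbb S^2)\to\mathbb C\to 0$. For a continuous map $\omega:\mathbb S^1\to\mathbb S^1$ with winding number $k\in\mathbb Z$ put $$W_\omega=\{\alpha\in C(\overline U):\ \alpha|_{\mathbb S^1}=\lambda\omega\ \text{for some }\lambda\in\mathbb C\},$$ a Hilbert $C^*$-module over $C(\mathbb S^2)$, where $C(\mathbb S^2)$ is identified with the algebra of continuous functions on $\overline U$ that are constant on $\mathbb S^1$, acting by pointwise multiplication, and the inner product is $\langle\alpha,\beta\rangle=\bar\alpha\beta$. The inclusion $C_0(U)\subset W_\omega$ and the map $\Pi(\alpha)=\lambda$ give an extension $0\to C_0(U)\to W_\omega\xrightarrow{\Pi}\mathbb C\to 0$ of Hilbert $C^*$-modules over $0\to C_0(U)\to C(\mathbb S^2)\to\mathbb C\to 0$. For a Hilbert $C^*$-module $V$ over $A$, let $M(V)$ be the module of adjointable operators $A\to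 V$ over the multiplier algebra $M(A)$, and let $Q(V)=M(V)/V$, over $Q(A)=M(A)/A$. The Busby invariant of an extension $0\to V\xrightarrow{\Phi}W\xrightarrow{\Pi}Z\to 0$ over $0\to A\xrightarrow{\varphi}B\to C\to 0$ is the map $\Delta_W:Z\to Q(V)$ sending $\Pi(w)$ to the class of the operator $a\mapsto\Phi^{-1}(w\,\varphi(a))$. A Hilbert $C^*$-module morphism $Z\to Q(V)$ is a map $\Delta$ such that $\langle\Delta z,\Delta z'\rangle=\delta(\langle z,z'\rangle)$ for some $*$-homomorphism $\delta:C\to Q(A)$. Two extensions $0\to V\to W_i\to Z\to0$, $i=0,1$, are homotopic if there are Hilbert $C^*$-module morphisms $\Delta_t:Z\to Q(V)$, $t\in[0,1]$, with $\Delta_i=\Delta_{W_i}$ for $i=0,1$ and $t\mapsto\Delta_t(z)$ norm-continuous for every $z\in Z$. **Theorem.** If $\omega,\omega':\mathbb S^1\to\mathbb S^1$ are continuous maps with different winding numbers $k\ne k'$, then the extensions $0\to C_0(U)\to W_\omega\to\mathbb C\to0$ and $0\to C_0(U)\to W_{\omega'}\to\mathbb C\to0$ are not homotopic. -/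

import Mathlib

open scoped ComplexOrder ZeroAtInfty MultiplierAlgebra

set_option linter.unusedSectionVars false

noncomputable section

namespace HilbertExt

/-! ### Hilbert modules over C⋆-algebras

Mathlib's `CStarModule A V` has a left action of `A` and an inner product which is linear in the
second variable, with `⟪x, a • y⟫ = a * ⟪x, y⟫`; the algebra `A` is a module over itself with
`⟪a, b⟫ = b * star a`. All formulas below are written in this convention (over commutative
algebras left and right modules are the same). -/

/-- A map `Φ` of Hilbert modules is a `φ`-morphism if `⟪Φ v, Φ v'⟫ = φ ⟪v, v'⟫`. -/
def IsHilbertModuleMorphism {A B V W : Type*} [NonUnitalNonAssocSemiring A] [Module ℂ A] [Star A]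
    [NonUnitalNonAssocSemiring B] [Module ℂ B] [Star B] [Inner A V] [Inner B W]
    (φ : A →⋆ₙₐ[ℂ] B) (Φ : V → W) : Prop :=
  ∀ v v' : V, inner B (Φ v) (Φ v') = φ (inner A v v')

section MultiplierAlgebra

variable (A : Type*) [NonUnitalCStarAlgebra A]

variable {A} in
/-- Continuous conjugation `x ↦ (f (x⋆))⋆` of an operator on `A`. -/
def starConj (f : A →L[ℂ] A) : A →L[ℂ] A :=
  LinearMap.mkContinuous
    { toFun := fun a => star (f (star a))
      map_add' := fun a b => by simp
      map_smul' := fun c a => by simp } ‖f‖ (fun a => by simpa using f.le_opNorm (star a))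

@[simp] theorem starConj_apply (f : A →L[ℂ] A) (a : A) : starConj f a = star (f (star a)) := rfl

variable {A} in
theorem mul_right_ext {x y : A} (h : ∀ z : A, x * z = y * z) : x = y := by
  rw [← sub_eq_zero, ← CStarRing.mul_star_self_eq_zero_iff, sub_mul, h, sub_self]

variable {A} in
theorem multiplier_ext {m n : 𝓜(ℂ, A)} (h : ∀ a, m.snd a = n.snd a) : m = n := by
  have h0 : (m - n).snd = 0 := by ext a; simp [h]
  rw [← sub_eq_zero, ← norm_eq_zero, ← DoubleCentralizer.norm_snd, h0, norm_zero]

/-- The ideal `A` of the multiplier algebra `M(A)`. -/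
def multiplierIdeal : Ideal 𝓜(ℂ, A) where
  carrier := {m | ∃ a : A, m = (a : 𝓜(ℂ, A))}
  add_mem' := by
    rintro _ _ ⟨a, rfl⟩ ⟨b, rfl⟩
    exact ⟨a + b, multiplier_ext fun x => by simp⟩
  zero_mem' := ⟨0, multiplier_ext fun x => by simp⟩
  smul_mem' := by
    rintro m _ ⟨a, rfl⟩
    exact ⟨m.fst a, multiplier_ext fun x => by simp [m.central]⟩

instance : (multiplierIdeal A).IsTwoSided where
  mul_mem_of_left {m} n := by
    rintro ⟨a, rfl⟩
    refine ⟨n.snd a, multiplier_ext fun x => mul_right_ext fun y => ?_⟩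
    simp [n.central, mul_assoc]

/-- The corona algebra `Q(A) = M(A) / A`. -/
abbrev CoronaAlgebra : Type _ := 𝓜(ℂ, A) ⧸ multiplierIdeal A

variable {A} in
theorem star_mem_multiplierIdeal {m : 𝓜(ℂ, A)} (h : m ∈ multiplierIdeal A) :
    star m ∈ multiplierIdeal A := by
  obtain ⟨a, rfl⟩ := h
  exact ⟨star a, multiplier_ext fun x => by simp⟩

instance : Star (CoronaAlgebra A) where
  star := Quotient.map' star fun m n h => by
    rw [Submodule.quotientRel_def] at h ⊢
    rw [← star_sub]
    exact star_mem_multiplierIdeal h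

end MultiplierAlgebra

section Multipliers

variable (A : Type*) [NonUnitalCStarAlgebra A] [PartialOrder A] [StarOrderedRing A]
variable (V : Type*) [NormedAddCommGroup V] [NormedSpace ℂ V] [SMul A V] [CStarModule A V]

variable {V} in
theorem ext_inner {x y : V} (h : ∀ z : V, inner A z x = inner A z y) : x = y := by
  rw [← sub_eq_zero, ← CStarModule.inner_self (A := A)]
  rw [CStarModule.inner_sub_right, h, sub_self]

/-- The multiplier module `M(V)`: the adjointable operators from `A` to `V`, with the operator
norm. -/
def multiplierModule : Submodule ℂ (A →L[ℂ] V) where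
  carrier := {T | ∃ S : V →L[ℂ] A, ∀ (a : A) (v : V), inner A (T a) v = inner A a (S v)}
  add_mem' := by
    rintro T T' ⟨S, hS⟩ ⟨S', hS'⟩
    exact ⟨S + S', fun a v => by simp [hS, hS']⟩
  zero_mem' := ⟨0, fun a v => by simp⟩
  smul_mem' := by
    rintro c T ⟨S, hS⟩
    exact ⟨star c • S, fun a v => by simp [hS]⟩

abbrev MultiplierModule : Type _ := ↥(multiplierModule A V)

variable {A V}

/-- The adjoint of a multiplier `T : A → V`. -/
def adjoint (T : MultiplierModule A V) : V →L[ℂ] A := T.2.choose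

theorem adjoint_spec (T : MultiplierModule A V) (a : A) (v : V) :
    inner A (T.1 a) v = adjoint T v * star a :=
  T.2.choose_spec a v

theorem adjoint_spec' (T : MultiplierModule A V) (a : A) (v : V) :
    inner A v (T.1 a) = a * star (adjoint T v) := by
  rw [← CStarModule.star_inner, adjoint_spec]; simp

/-- The `M(A)`-valued inner product `⟪T, S⟫ = T⋆ S` on `M(V)`. The operator `T⋆ S` on `A` commutes
with left multiplications, so it is the right multiplication by an element of `M(A)`; the left
multiplication by the same element is `a ↦ (S⋆ T a⋆)⋆`. -/
def multiplierInner (T S : MultiplierModule A V) : 𝓜(ℂ, A) where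
  fst := starConj ((adjoint S).comp T.1)
  snd := (adjoint T).comp S.1
  central := by
    intro x y
    have h := adjoint_spec T (star y) (S.1 x)
    rw [adjoint_spec' S] at h
    simpa using h.symm

instance : Inner 𝓜(ℂ, A) (MultiplierModule A V) := ⟨multiplierInner⟩

theorem inner_snd (T S : MultiplierModule A V) (a : A) :
    (inner 𝓜(ℂ, A) T S).snd a = adjoint T (S.1 a) := rfl

theorem smul_add_right' (a : A) (v w : V) : a • (v + w) = a • v + a • w :=
  ext_inner A fun z => by simp [mul_add]

theorem smul_add_left' (a b : A) (v : V) : (a + b) • v = a • v + b • v :=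
  ext_inner A fun z => by simp [add_mul]

theorem smul_smul_right' (a : A) (c : ℂ) (v : V) : a • (c • v) = c • (a • v) :=
  ext_inner A fun z => by simp [mul_smul_comm]

theorem smul_smul_left' (a : A) (c : ℂ) (v : V) : (c • a) • v = c • (a • v) :=
  ext_inner A fun z => by simp [smul_mul_assoc]

theorem norm_smul_le' (a : A) (v : V) : ‖a • v‖ ≤ ‖a‖ * ‖v‖ := by
  refine (pow_le_pow_iff_left₀ (norm_nonneg _) (by positivity) two_ne_zero).1 ?_
  rw [CStarModule.norm_sq_eq (A := A), CStarModule.inner_op_smul_right,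
    CStarModule.inner_op_smul_left, mul_pow, CStarModule.norm_sq_eq (A := A) (x := v)]
  calc ‖a * (inner A v v * star a)‖ ≤ ‖a‖ * (‖(inner A v v : A)‖ * ‖star a‖) :=
        (norm_mul_le _ _).trans (by gcongr; exact norm_mul_le _ _)
    _ = _ := by rw [norm_star]; ring

variable (A V) in
/-- The embedding `Γ : V → M(V)`, `Γ v a = a • v`. -/
def Γ : V →ₗ[ℂ] MultiplierModule A V where
  toFun v :=
    ⟨LinearMap.mkContinuous
      { toFun := fun a => a • v
        map_add' := fun a b => smul_add_left' a b v
        map_smul' := fun c a => smul_smul_left' a c v } ‖v‖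
        (fun a => (norm_smul_le' a v).trans_eq (mul_comm _ _)),
      CStarModule.innerSL v, fun a w => by
        change inner A (a • v) w = inner A v w * star a
        simp⟩
  map_add' v w := by ext a; exact smul_add_right' a v w
  map_smul' c v := by ext a; exact smul_smul_right' a c v

@[simp] theorem Γ_apply (v : V) (a : A) : (Γ A V v).1 a = a • v := rfl

variable (A V) in
/-- The quotient `Q(V) = M(V) / V`, with the quotient norm. -/
abbrev CoronaModule : Type _ := MultiplierModule A V ⧸ LinearMap.range (Γ A V)

theorem inner_sub_right' (T S S' : MultiplierModule A V) :
    inner 𝓜(ℂ, A) T (S - S') = inner 𝓜(ℂ, A) T S - inner 𝓜(ℂ, A) T S' :=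
  multiplier_ext fun a => by simp [inner_snd]

theorem star_inner' (T S : MultiplierModule A V) :
    star (inner 𝓜(ℂ, A) T S) = inner 𝓜(ℂ, A) S T :=
  multiplier_ext fun a => by
    change star (star ((adjoint S) (T.1 (star (star a))))) = adjoint S (T.1 a)
    simp

theorem inner_Γ_mem (T : MultiplierModule A V) (v : V) :
    inner 𝓜(ℂ, A) T (Γ A V v) ∈ multiplierIdeal A := by
  refine ⟨adjoint T v, multiplier_ext fun a => mul_right_ext fun b => ?_⟩
  have h := adjoint_spec T (star b) (a • v)
  have h' := adjoint_spec T (star b) v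
  simp only [CStarModule.inner_op_smul_right, star_star] at h h'
  simp [inner_snd, ← h, h', mul_assoc]

/-- The `Q(A)`-valued inner product on `Q(V)` induced by that of `M(V)`. -/
instance : Inner (CoronaAlgebra A) (CoronaModule A V) where
  inner := Quotient.map₂ (fun T S => inner 𝓜(ℂ, A) T S) (by
    intro T T' h S S' h'
    rw [← Quotient.eq_iff_equiv, Quotient.eq, Submodule.quotientRel_def] at h h' ⊢
    obtain ⟨v, hv⟩ := h
    obtain ⟨w, hw⟩ := h'
    have e : inner 𝓜(ℂ, A) T S - inner 𝓜(ℂ, A) T' S' =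
        star (inner 𝓜(ℂ, A) S (T - T')) + inner 𝓜(ℂ, A) T' (S - S') := by
      simp only [inner_sub_right', star_sub, star_inner']
      abel
    rw [e, ← hv, ← hw]
    exact add_mem (star_mem_multiplierIdeal (inner_Γ_mem _ _)) (inner_Γ_mem _ _))

theorem corona_inner_mk (T S : MultiplierModule A V) :
    inner (CoronaAlgebra A) (Submodule.Quotient.mk T : CoronaModule A V)
      (Submodule.Quotient.mk S : CoronaModule A V) =
    Ideal.Quotient.mk (multiplierIdeal A) (inner 𝓜(ℂ, A) T S) := rfl

end Multipliers


/-! ### Extensions and their Busby invariants -/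

/-- An essential extension `0 → A → B → C → 0` of C⋆-algebras. -/
structure CStarExtension (A B C : Type*) [NonUnitalCStarAlgebra A] [NonUnitalCStarAlgebra B]
    [NonUnitalCStarAlgebra C] where
  φ : A →⋆ₙₐ[ℂ] B
  π : B →⋆ₙₐ[ℂ] C
  injective : Function.Injective φ
  surjective : Function.Surjective π
  exact : ∀ b, π b = 0 ↔ b ∈ Set.range φ
  essential : ∀ b, (∀ a, b * φ a = 0) → b = 0

section Extensions

variable {A B C : Type*} [NonUnitalCStarAlgebra A] [PartialOrder A] [StarOrderedRing A]
  [NonUnitalCStarAlgebra B] [PartialOrder B] [StarOrderedRing B]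
  [NonUnitalCStarAlgebra C] [PartialOrder C] [StarOrderedRing C]

/-- An extension `0 → V → W → Z → 0` of Hilbert modules over `A`, `B`, `C`, with the underlying
extension `0 → A → B → C → 0` of C⋆-algebras. -/
structure HilbertModuleExtension (E : CStarExtension A B C) (V W Z : Type*)
    [NormedAddCommGroup V] [NormedSpace ℂ V] [CompleteSpace V] [SMul A V] [CStarModule A V]
    [NormedAddCommGroup W] [NormedSpace ℂ W] [CompleteSpace W] [SMul B W] [CStarModule B W]
    [NormedAddCommGroup Z] [NormedSpace ℂ Z] [CompleteSpace Z] [SMul C Z] [CStarModule C Z] where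
  Φ : V → W
  Ψ : W → Z
  Φ_morphism : IsHilbertModuleMorphism E.φ Φ
  Ψ_morphism : IsHilbertModuleMorphism E.π Ψ
  injective : Function.Injective Φ
  surjective : Function.Surjective Ψ
  exact : ∀ w, Ψ w = 0 ↔ w ∈ Set.range Φ

section Morphism

variable {V W : Type*}
    [NormedAddCommGroup V] [NormedSpace ℂ V] [SMul A V] [CStarModule A V]
    [NormedAddCommGroup W] [NormedSpace ℂ W] [SMul B W] [CStarModule B W]
    {φ : A →⋆ₙₐ[ℂ] B} {Φ : V → W}

theorem IsHilbertModuleMorphism.map_add (h : IsHilbertModuleMorphism φ Φ) (v w : V) :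
    Φ (v + w) = Φ v + Φ w := by
  rw [← sub_eq_zero, ← CStarModule.inner_self (A := B)]
  simp only [CStarModule.inner_sub_right, CStarModule.inner_sub_left, CStarModule.inner_add_right,
    CStarModule.inner_add_left, h _ _, _root_.map_add]
  abel

theorem IsHilbertModuleMorphism.map_smul (h : IsHilbertModuleMorphism φ Φ) (c : ℂ) (v : V) :
    Φ (c • v) = c • Φ v := by
  rw [← sub_eq_zero, ← CStarModule.inner_self (A := B)]
  simp only [CStarModule.inner_sub_right, CStarModule.inner_sub_left,
    CStarModule.inner_smul_right_complex, CStarModule.inner_smul_left_complex, h _ _,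
    _root_.map_smul, smul_comm c (star c), sub_self, smul_zero]

theorem IsHilbertModuleMorphism.map_action (h : IsHilbertModuleMorphism φ Φ) (a : A) (v : V) :
    Φ (a • v) = φ a • Φ v := by
  rw [← sub_eq_zero, ← CStarModule.inner_self (A := B)]
  simp [h _ _, map_star, mul_assoc]

theorem IsHilbertModuleMorphism.map_sub (h : IsHilbertModuleMorphism φ Φ) (v w : V) :
    Φ (v - w) = Φ v - Φ w := by
  rw [eq_sub_iff_add_eq, ← h.map_add, sub_add_cancel]

end Morphism

namespace HilbertModuleExtension

variable {E : CStarExtension A B C} {V W W' Z : Type*}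
    [NormedAddCommGroup V] [NormedSpace ℂ V] [CompleteSpace V] [SMul A V] [CStarModule A V]
    [NormedAddCommGroup W] [NormedSpace ℂ W] [CompleteSpace W] [SMul B W] [CStarModule B W]
    [NormedAddCommGroup W'] [NormedSpace ℂ W'] [CompleteSpace W'] [SMul B W'] [CStarModule B W']
    [NormedAddCommGroup Z] [NormedSpace ℂ Z] [CompleteSpace Z] [SMul C Z] [CStarModule C Z]

theorem norm_Φ (F : HilbertModuleExtension E V W Z) (v : V) : ‖F.Φ v‖ = ‖v‖ := by
  rw [CStarModule.norm_eq_sqrt_norm_inner_self (A := B), F.Φ_morphism,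
    CStarModule.norm_eq_sqrt_norm_inner_self (A := A) (x := v),
    NonUnitalStarAlgHom.norm_map E.φ E.injective]

theorem smul_mem_range (F : HilbertModuleExtension E V W Z) (w : W) (a : A) :
    ∃ v, F.Φ v = E.φ a • w := by
  have h : F.Ψ (E.φ a • w) = 0 := by
    rw [F.Ψ_morphism.map_action, (E.exact _).2 ⟨a, rfl⟩, ← CStarModule.inner_self (A := C)]
    simp
  exact (F.exact _).1 h

theorem inner_mem_range (F : HilbertModuleExtension E V W Z) (w : W) (v : V) :
    ∃ a, E.φ a = inner B w (F.Φ v) := by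
  refine (E.exact _).1 ?_
  rw [← F.Ψ_morphism, (F.exact _).2 ⟨v, rfl⟩]
  simp

/-- `ΛFun w a` is the element of `V` which `Φ` maps to `φ a • w`. -/
def ΛFun (F : HilbertModuleExtension E V W Z) (w : W) (a : A) : V := (F.smul_mem_range w a).choose

theorem Φ_ΛFun (F : HilbertModuleExtension E V W Z) (w : W) (a : A) :
    F.Φ (F.ΛFun w a) = E.φ a • w := (F.smul_mem_range w a).choose_spec

/-- The adjoint of `ΛFun w` maps `v` to the element of `A` which `φ` maps to `⟪w, Φ v⟫`. -/
def ΛAdj (F : HilbertModuleExtension E V W Z) (w : W) (v : V) : A := (F.inner_mem_range w v).choose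

theorem φ_ΛAdj (F : HilbertModuleExtension E V W Z) (w : W) (v : V) :
    E.φ (F.ΛAdj w v) = inner B w (F.Φ v) := (F.inner_mem_range w v).choose_spec

/-- The canonical map `Λ : W → M(V)`, determined by `Φ (Λ w a) = φ a • w`. -/
def Λ (F : HilbertModuleExtension E V W Z) (w : W) : MultiplierModule A V :=
  ⟨LinearMap.mkContinuous
    { toFun := F.ΛFun w
      map_add' := fun a b => F.injective <| by
        simp only [F.Φ_morphism.map_add, Φ_ΛFun, map_add, smul_add_left']
      map_smul' := fun c a => F.injective <| by
        simp only [F.Φ_morphism.map_smul, Φ_ΛFun, map_smul, smul_smul_left', RingHom.id_apply] }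
    ‖w‖ (fun a => by
      change ‖F.ΛFun w a‖ ≤ _
      rw [← F.norm_Φ, Φ_ΛFun, mul_comm, ← NonUnitalStarAlgHom.norm_map E.φ E.injective]
      exact norm_smul_le' _ _),
   LinearMap.mkContinuous
    { toFun := F.ΛAdj w
      map_add' := fun a b => E.injective <| by
        simp only [F.Φ_morphism.map_add, φ_ΛAdj, map_add, CStarModule.inner_add_right]
      map_smul' := fun c a => E.injective <| by
        simp only [F.Φ_morphism.map_smul, φ_ΛAdj, map_smul, CStarModule.inner_smul_right_complex,
          RingHom.id_apply] }
    ‖w‖ (fun v => by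
      change ‖F.ΛAdj w v‖ ≤ _
      rw [← F.norm_Φ, ← NonUnitalStarAlgHom.norm_map E.φ E.injective, φ_ΛAdj]
      exact CStarModule.norm_inner_le W),
   fun a v => E.injective <| by
      change E.φ (inner A (F.ΛFun w a) v) = E.φ (F.ΛAdj w v * star a)
      rw [← F.Φ_morphism, Φ_ΛFun, map_mul, φ_ΛAdj, map_star, CStarModule.inner_op_smul_left]⟩

theorem Φ_Λ (F : HilbertModuleExtension E V W Z) (w : W) (a : A) :
    F.Φ ((F.Λ w).1 a) = E.φ a • w := F.Φ_ΛFun w a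

theorem Λ_Φ (F : HilbertModuleExtension E V W Z) (v : V) : F.Λ (F.Φ v) = Γ A V v := by
  ext a
  exact F.injective <| by rw [Φ_Λ, Γ_apply, F.Φ_morphism.map_action]

theorem Λ_add (F : HilbertModuleExtension E V W Z) (w w' : W) : F.Λ (w + w') = F.Λ w + F.Λ w' := by
  ext a
  refine F.injective ?_
  change F.Φ ((F.Λ (w + w')).1 a) = F.Φ ((F.Λ w).1 a + (F.Λ w').1 a)
  rw [F.Φ_morphism.map_add, Φ_Λ, Φ_Λ, Φ_Λ, smul_add_right']

/-- The Busby invariant `Δ : Z → Q(V)`, which maps `Ψ w` to the class of `Λ w`. -/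
def busby (F : HilbertModuleExtension E V W Z) (z : Z) : CoronaModule A V :=
  Submodule.Quotient.mk (F.Λ (F.surjective z).choose)

theorem busby_Ψ (F : HilbertModuleExtension E V W Z) (w : W) :
    F.busby (F.Ψ w) = Submodule.Quotient.mk (F.Λ w) := by
  have h := (F.surjective (F.Ψ w)).choose_spec
  rw [busby, Submodule.Quotient.eq]
  set w' := (F.surjective (F.Ψ w)).choose
  obtain ⟨v, hv⟩ := (F.exact (w' - w)).1 (by rw [F.Ψ_morphism.map_sub, h, sub_self])
  refine ⟨v, ?_⟩
  rw [← F.Λ_Φ, hv, eq_sub_iff_add_eq, ← Λ_add, sub_add_cancel]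

/-- Two extensions of `Z` by `V` are homotopic if their Busby invariants are the endpoints of a path
of Hilbert module morphisms `Δ t : Z → Q(V)` such that `t ↦ Δ t z` is norm-continuous for every
`z`. -/
def Homotopic (F : HilbertModuleExtension E V W Z) (F' : HilbertModuleExtension E V W' Z) : Prop :=
  ∃ Δ : unitInterval → Z → CoronaModule A V,
    (∀ t, ∃ δ : C →⋆ₙₐ[ℂ] CoronaAlgebra A, IsHilbertModuleMorphism δ (Δ t)) ∧
    Δ 0 = F.busby ∧ Δ 1 = F'.busby ∧ ∀ z, Continuous fun t => Δ t z

end HilbertModuleExtension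

end Extensions


/-! ### The extensions of the disc -/

/-- The open unit disc. -/
abbrev Disc : Type := ↥(Metric.ball (0 : ℂ) 1)

/-- The closed unit disc. -/
abbrev ClosedDisc : Type := ↥(Metric.closedBall (0 : ℂ) 1)

instance : LocallyCompactSpace Disc := Metric.isOpen_ball.locallyCompactSpace

instance : CompactSpace ClosedDisc := isCompact_iff_compactSpace.1 (isCompact_closedBall _ _)

/-- The positive elements of `C₀(U)` are those of the C⋆-algebra order. -/
instance : PartialOrder C₀(Disc, ℂ) := CStarAlgebra.spectralOrder _

instance : StarOrderedRing C₀(Disc, ℂ) := CStarAlgebra.spectralOrderedRing _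

/-- The inclusion of the open disc in the closed disc. -/
def interior : C(Disc, ClosedDisc) where
  toFun z := ⟨z.1, Metric.ball_subset_closedBall z.2⟩

/-- The inclusion of the unit circle in the closed disc. -/
def boundary : C(Circle, ClosedDisc) where
  toFun z := ⟨z, mem_closedBall_zero_iff.2 z.norm_coe.le⟩

theorem closedDisc_cases (z : ClosedDisc) : (∃ x, interior x = z) ∨ ∃ w, boundary w = z := by
  have h : ‖z.1‖ ≤ 1 := mem_closedBall_zero_iff.1 z.2
  rcases h.lt_or_eq with h | h
  · exact Or.inl ⟨⟨z.1, mem_ball_zero_iff.2 h⟩, rfl⟩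
  · exact Or.inr ⟨⟨z.1, mem_sphere_zero_iff_norm.2 h⟩, rfl⟩

theorem isOpenEmbedding_interior : Topology.IsOpenEmbedding interior := by
  refine Topology.IsOpenEmbedding.inclusion Metric.ball_subset_closedBall ?_
  exact Metric.isOpen_ball.preimage continuous_subtype_val

/-- The map of the closed disc onto the one-point compactification `U ∪ {∞} ≅ S²` of the open disc,
which collapses the boundary circle to `∞`. -/
def collapseFun (z : ClosedDisc) : OnePoint Disc :=
  if h : ‖z.1‖ < 1 then ((⟨z.1, mem_ball_zero_iff.2 h⟩ : Disc) : OnePoint Disc) else OnePoint.infty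

theorem collapseFun_interior (x : Disc) : collapseFun (interior x) = x := by
  have h : ‖x.1‖ < 1 := mem_ball_zero_iff.1 x.2
  simp [collapseFun, interior, h]

theorem collapseFun_boundary (w : Circle) : collapseFun (boundary w) = OnePoint.infty := by
  have h : ¬ ‖(boundary w).1‖ < 1 := w.norm_coe.not_lt
  simp only [collapseFun, h, dite_false]

theorem continuous_collapseFun : Continuous collapseFun := by
  refine ⟨fun s hs => ?_⟩
  by_cases h : OnePoint.infty ∈ s
  · have e : collapseFun ⁻¹' s = (interior '' ((fun x : Disc => (x : OnePoint Disc)) ⁻¹' s)ᶜ)ᶜ := by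
      ext z
      rcases closedDisc_cases z with ⟨x, rfl⟩ | ⟨w, rfl⟩
      · simp [collapseFun_interior, isOpenEmbedding_interior.injective.eq_iff]
      · simp only [Set.mem_preimage, collapseFun_boundary, h, true_iff, Set.mem_compl_iff]
        rintro ⟨x, -, hx⟩
        have := congrArg collapseFun hx
        simp [collapseFun_interior, collapseFun_boundary] at this
    rw [e, isOpen_compl_iff]
    exact (((OnePoint.isOpen_iff_of_mem h).1 hs).2.image interior.continuous).isClosed
  · have e : collapseFun ⁻¹' s = interior '' ((fun x : Disc => (x : OnePoint Disc)) ⁻¹' s) := by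
      ext z
      rcases closedDisc_cases z with ⟨x, rfl⟩ | ⟨w, rfl⟩
      · simp [collapseFun_interior, isOpenEmbedding_interior.injective.eq_iff]
      · simp only [Set.mem_preimage, collapseFun_boundary, h, false_iff]
        rintro ⟨x, -, hx⟩
        have := congrArg collapseFun hx
        simp [collapseFun_interior, collapseFun_boundary] at this
    rw [e]
    exact isOpenEmbedding_interior.isOpenMap _ ((OnePoint.isOpen_iff_of_notMem h).1 hs)

/-- The continuous map `collapseFun`. -/
def collapse : C(ClosedDisc, OnePoint Disc) := ⟨collapseFun, continuous_collapseFun⟩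

@[simp] theorem collapse_interior (x : Disc) : collapse (interior x) = x := collapseFun_interior x

@[simp] theorem collapse_boundary (w : Circle) : collapse (boundary w) = OnePoint.infty :=
  collapseFun_boundary w

theorem collapse_surjective : Function.Surjective collapse := by
  intro p
  induction p using OnePoint.rec with
  | infty => exact ⟨boundary 1, by simp⟩
  | coe x => exact ⟨interior x, by simp⟩

theorem isQuotientMap_collapse : Topology.IsQuotientMap collapse :=
  collapse.continuous.isClosedMap.isQuotientMap collapse.continuous collapse_surjective

theorem factorsThrough_collapse {g : C(ClosedDisc, ℂ)} {c : ℂ}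
    (hg : ∀ w : Circle, g (boundary w) = c) : Function.FactorsThrough g collapse := by
  intro y z h
  rcases closedDisc_cases y with ⟨x, rfl⟩ | ⟨w, rfl⟩ <;>
  rcases closedDisc_cases z with ⟨x', rfl⟩ | ⟨w', rfl⟩
  · simp only [collapse_interior, OnePoint.coe_eq_coe] at h; rw [h]
  · simp at h
  · simp at h
  · rw [hg, hg]

/-- A function on the closed disc which is constant on the boundary, as a function on the sphere. -/
def descend (g : C(ClosedDisc, ℂ)) {c : ℂ} (hg : ∀ w : Circle, g (boundary w) = c) :
    C(OnePoint Disc, ℂ) :=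
  isQuotientMap_collapse.lift g (factorsThrough_collapse hg)

@[simp] theorem descend_collapse (g : C(ClosedDisc, ℂ)) {c : ℂ}
    (hg : ∀ w : Circle, g (boundary w) = c) (z : ClosedDisc) :
    descend g hg (collapse z) = g z :=
  DFunLike.congr_fun (isQuotientMap_collapse.lift_comp g (factorsThrough_collapse hg)) z

theorem sphere_ext {f g : C(OnePoint Disc, ℂ)} (h : ∀ z, f (collapse z) = g (collapse z)) :
    f = g := by
  ext p
  obtain ⟨z, rfl⟩ := collapse_surjective p
  exact h z

/-- The embedding `C₀(U) → C(S²)`, extension by zero at `∞`. -/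
def extendZero : C₀(Disc, ℂ) →⋆ₙₐ[ℂ] C(OnePoint Disc, ℂ) where
  toFun f := OnePoint.continuousMapMk f.toContinuousMap 0 (by
    simpa [Filter.coclosedCompact_eq_cocompact] using f.zero_at_infty')
  map_smul' c f := by ext p; induction p using OnePoint.rec <;> simp [OnePoint.continuousMapMk]
  map_zero' := by ext p; induction p using OnePoint.rec <;> simp [OnePoint.continuousMapMk]
  map_add' f g := by ext p; induction p using OnePoint.rec <;> simp [OnePoint.continuousMapMk]
  map_mul' f g := by ext p; induction p using OnePoint.rec <;> simp [OnePoint.continuousMapMk]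
  map_star' f := by ext p; induction p using OnePoint.rec <;> simp [OnePoint.continuousMapMk]

@[simp] theorem extendZero_coe (f : C₀(Disc, ℂ)) (x : Disc) : extendZero f x = f x := rfl

@[simp] theorem extendZero_infty (f : C₀(Disc, ℂ)) : extendZero f OnePoint.infty = 0 := rfl

/-- The evaluation `C(S²) → ℂ` at `∞`. -/
def evalInfty : C(OnePoint Disc, ℂ) →⋆ₙₐ[ℂ] ℂ where
  toFun f := f OnePoint.infty
  map_smul' _ _ := rfl
  map_zero' := rfl
  map_add' _ _ := rfl
  map_mul' _ _ := rfl
  map_star' _ := rfl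

@[simp] theorem evalInfty_apply (f : C(OnePoint Disc, ℂ)) : evalInfty f = f OnePoint.infty := rfl

theorem exists_extendZero {b : C(OnePoint Disc, ℂ)} (h : b OnePoint.infty = 0) :
    ∃ f, extendZero f = b := by
  refine ⟨⟨⟨fun x => b x, b.continuous.comp OnePoint.continuous_coe⟩, ?_⟩, ?_⟩
  · have h' := (b.continuous.tendsto _).comp (OnePoint.tendsto_coe_infty (X := Disc))
    rwa [h, Filter.coclosedCompact_eq_cocompact] at h'
  · ext p
    induction p using OnePoint.rec with
    | infty => simp [h]
    | coe x => rfl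

instance : NoncompactSpace Disc := by
  rw [← not_compactSpace_iff, ← isCompact_iff_compactSpace]
  intro h
  have h1 := h.isClosed.closure_eq
  rw [closure_ball _ one_ne_zero] at h1
  have h2 : (1 : ℂ) ∈ Metric.closedBall (0 : ℂ) 1 := by simp
  rw [h1] at h2
  simp at h2

/-- The function `1 - |z|²` on the closed disc. -/
def bump : C(ClosedDisc, ℂ) := ⟨fun z => 1 - (‖z.1‖ : ℂ) ^ 2, by fun_prop⟩

theorem bump_boundary (w : Circle) : bump (boundary w) = 0 := by
  have h : ‖(boundary w).1‖ = 1 := w.norm_coe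
  simp [bump, h]

theorem bump_interior (x : Disc) : bump (interior x) ≠ 0 := by
  have h : ‖x.1‖ < 1 := mem_ball_zero_iff.1 x.2
  have h' : (1 : ℝ) - ‖x.1‖ ^ 2 ≠ 0 := by nlinarith [norm_nonneg x.1]
  simp only [bump, interior, ContinuousMap.coe_mk]
  exact_mod_cast h'

/-- The extension `0 → C₀(U) → C(S²) → ℂ → 0`. -/
def sphereExtension : CStarExtension C₀(Disc, ℂ) C(OnePoint Disc, ℂ) ℂ where
  φ := extendZero
  π := evalInfty
  injective f g h := by
    ext x
    simpa using DFunLike.congr_fun h (x : OnePoint Disc)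
  surjective c := ⟨ContinuousMap.const _ c, rfl⟩
  exact b := by
    refine ⟨fun h => exists_extendZero h, ?_⟩
    rintro ⟨f, rfl⟩
    simp
  essential b hb := by
    obtain ⟨f, hf⟩ := exists_extendZero (b := descend bump bump_boundary) (by
      rw [← collapse_boundary 1, descend_collapse, bump_boundary])
    have h (x : Disc) : b x = 0 := by
      have := DFunLike.congr_fun (hb f) (x : OnePoint Disc)
      rw [hf, ContinuousMap.mul_apply, ← collapse_interior, descend_collapse] at this
      rw [← collapse_interior]
      exact (mul_eq_zero.1 this).resolve_right (bump_interior x)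
    exact DFunLike.coe_injective
      (OnePoint.denseRange_coe.equalizer b.continuous continuous_const (funext h))

/-- The module `W` of the functions on the closed disc whose boundary value is a multiple of
`ω`. -/
def windingModule (ω : C(Circle, Circle)) : Submodule ℂ C(ClosedDisc, ℂ) where
  carrier := {α | ∃ c : ℂ, ∀ w : Circle, α (boundary w) = c * ω w}
  add_mem' := by
    rintro α β ⟨c, hc⟩ ⟨d, hd⟩
    exact ⟨c + d, fun w => by simp [hc, hd, add_mul]⟩
  zero_mem' := ⟨0, by simp⟩
  smul_mem' := by
    rintro k α ⟨c, hc⟩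
    exact ⟨k * c, fun w => by simp [hc, mul_assoc]⟩

abbrev WindingModule (ω : C(Circle, Circle)) : Type := ↥(windingModule ω)

section

variable {ω : C(Circle, Circle)}

/-- The `c` such that the boundary value of `α` is `c * ω`. -/
def boundaryCoeff (α : WindingModule ω) : ℂ := α.2.choose

theorem boundaryCoeff_spec (α : WindingModule ω) (w : Circle) :
    α.1 (boundary w) = boundaryCoeff α * ω w := α.2.choose_spec w

theorem boundaryCoeff_eq {α : WindingModule ω} {c : ℂ} {w : Circle}
    (h : α.1 (boundary w) = c * ω w) : boundaryCoeff α = c := by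
  rw [boundaryCoeff_spec] at h
  exact mul_right_cancel₀ (Circle.coe_ne_zero _) h

/-- Functions on the sphere act by multiplication. -/
instance : SMul C(OnePoint Disc, ℂ) (WindingModule ω) where
  smul f α := ⟨f.comp collapse * α.1, f OnePoint.infty * boundaryCoeff α, fun w => by
    simp [boundaryCoeff_spec, mul_assoc]⟩

@[simp] theorem action_apply (f : C(OnePoint Disc, ℂ)) (α : WindingModule ω) (z : ClosedDisc) :
    (f • α).1 z = f (collapse z) * α.1 z := rfl

theorem inner_boundary (α β : WindingModule ω) (w : Circle) :
    (β.1 * star α.1) (boundary w) = boundaryCoeff β * star (boundaryCoeff α) := by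
  have h : (ω w : ℂ) * star (ω w : ℂ) = 1 := by
    rw [Complex.star_def, Complex.mul_conj]; simp
  simp only [ContinuousMap.mul_apply, ContinuousMap.star_apply, boundaryCoeff_spec, star_mul']
  linear_combination (boundaryCoeff β * star (boundaryCoeff α)) * h

/-- The inner product `⟪α, β⟫ = β * conj α`, which is constant on the boundary of the disc. -/
instance : Inner C(OnePoint Disc, ℂ) (WindingModule ω) where
  inner α β := descend (β.1 * star α.1) (inner_boundary α β)

@[simp] theorem inner_collapse (α β : WindingModule ω) (z : ClosedDisc) :
    (inner C(OnePoint Disc, ℂ) α β) (collapse z) = β.1 z * star (α.1 z) :=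
  descend_collapse _ (inner_boundary α β) z

theorem norm_inner_self (α : WindingModule ω) :
    ‖inner C(OnePoint Disc, ℂ) α α‖ = ‖α‖ ^ 2 := by
  have e : (inner C(OnePoint Disc, ℂ) α α).comp collapse = α.1 * star α.1 := by
    ext z; simp
  have h : ‖(inner C(OnePoint Disc, ℂ) α α).comp collapse‖ = ‖α‖ ^ 2 := by
    rw [e, CStarRing.norm_self_mul_star, sq]; rfl
  rw [← h]
  refine le_antisymm ?_ ?_
  · rw [ContinuousMap.norm_le _ (norm_nonneg _)]
    intro p
    obtain ⟨z, rfl⟩ := collapse_surjective p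
    exact ((inner C(OnePoint Disc, ℂ) α α).comp collapse).norm_coe_le_norm z
  · rw [ContinuousMap.norm_le _ (norm_nonneg _)]
    exact fun z => ContinuousMap.norm_coe_le_norm (inner C(OnePoint Disc, ℂ) α α) (collapse z)

instance : CStarModule C(OnePoint Disc, ℂ) (WindingModule ω) where
  inner_add_right := sphere_ext fun z => by simp [add_mul]
  inner_self_nonneg := by
    intro α p
    obtain ⟨z, rfl⟩ := collapse_surjective p
    change 0 ≤ (inner C(OnePoint Disc, ℂ) α α) (collapse z)
    rw [inner_collapse]
    exact mul_star_self_nonneg _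
  inner_self := by
    intro α
    rw [← norm_eq_zero, norm_inner_self, pow_eq_zero_iff two_ne_zero, norm_eq_zero]
  inner_op_smul_right := sphere_ext fun z => by simp [mul_assoc]
  inner_smul_right_complex := sphere_ext fun z => by simp [mul_assoc]
  star_inner _ _ := sphere_ext fun z => by simp [mul_comm]
  norm_eq_sqrt_norm_inner_self α := by rw [norm_inner_self, Real.sqrt_sq (norm_nonneg _)]

instance : CompleteSpace (WindingModule ω) := by
  refine IsClosed.completeSpace_coe (hs := ?_)
  have e : (windingModule ω : Set C(ClosedDisc, ℂ)) =
      ⋂ w : Circle, {α | α (boundary w) * (ω 1 : ℂ) = α (boundary 1) * (ω w : ℂ)} := by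
    ext α
    simp only [Set.mem_iInter, Set.mem_ofPred_eq, SetLike.mem_coe]
    constructor
    · rintro ⟨c, hc⟩ w
      rw [hc, hc]; ring
    · intro h
      refine ⟨α (boundary 1) * (ω 1 : ℂ)⁻¹, fun w => ?_⟩
      have h1 : (ω 1 : ℂ) ≠ 0 := Circle.coe_ne_zero _
      field_simp
      exact h w
  rw [e]
  exact isClosed_iInter fun w => isClosed_eq (by fun_prop) (by fun_prop)

/-- A function in `C₀(U)`, extended by zero to the closed disc. -/
def extendDisc (ω : C(Circle, Circle)) (f : C₀(Disc, ℂ)) : WindingModule ω :=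
  ⟨(extendZero f).comp collapse, 0, fun w => by simp⟩

@[simp] theorem extendDisc_apply (f : C₀(Disc, ℂ)) (z : ClosedDisc) :
    (extendDisc ω f).1 z = extendZero f (collapse z) := rfl

/-- The extension `0 → C₀(U) → W → ℂ → 0` of Hilbert modules defined by `ω`: the first map is the
inclusion and the second one maps `α` to the `c` with `α = c * ω` on the boundary. -/
def windingExtension (ω : C(Circle, Circle)) :
    HilbertModuleExtension sphereExtension C₀(Disc, ℂ) (WindingModule ω) ℂ where
  Φ := extendDisc ω
  Ψ := boundaryCoeff
  Φ_morphism f g := sphere_ext fun z => by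
    rw [inner_collapse]
    change _ = extendZero (g * star f) (collapse z)
    rw [map_mul, map_star]
    rfl
  Ψ_morphism α β := by
    change boundaryCoeff β * star (boundaryCoeff α) =
      (inner C(OnePoint Disc, ℂ) α β) OnePoint.infty
    rw [← inner_boundary α β 1, ← collapse_boundary 1, inner_collapse]
    rfl
  injective f g h := by
    ext x
    have := congrArg (fun α : WindingModule ω => α.1 (interior x)) h
    simpa using this
  surjective c := by
    have he : Topology.IsClosedEmbedding boundary :=
      boundary.continuous.isClosedEmbedding fun w w' h =>
        Circle.ext (congrArg (fun z : ClosedDisc => (z : ℂ)) h)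
    obtain ⟨g, hg⟩ := ContinuousMap.exists_extension' he
      (⟨fun w => c * ω w, by fun_prop⟩ : C(Circle, ℂ))
    have hg' (w : Circle) : g (boundary w) = c * ω w := congrFun hg w
    exact ⟨⟨g, c, hg'⟩, boundaryCoeff_eq (hg' 1)⟩
  exact α := by
    constructor
    · intro h
      have hα (w : Circle) : α.1 (boundary w) = 0 := by rw [boundaryCoeff_spec, h, zero_mul]
      obtain ⟨f, hf⟩ := exists_extendZero (b := descend α.1 hα) (by
        rw [← collapse_boundary 1, descend_collapse, hα])
      refine ⟨f, Subtype.ext (ContinuousMap.ext fun z => ?_)⟩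
      rw [extendDisc_apply, hf, descend_collapse]
    · rintro ⟨f, rfl⟩
      exact boundaryCoeff_eq (w := 1) (by simp)

end

/-- A continuous map `ω` of the circle to itself has winding number `k` if it lifts to a map `θ` of
angles, `ω (e^{it}) = e^{iθ(t)}`, with `θ(2π) - θ(0) = 2πk`. -/
def HasWindingNumber (ω : C(Circle, Circle)) (k : ℤ) : Prop :=
  ∃ θ : C(ℝ, ℝ), (∀ t, ω (Circle.exp t) = Circle.exp (θ t)) ∧
    θ (2 * Real.pi) - θ 0 = 2 * Real.pi * k

end HilbertExt

end

noncomputable section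
namespace HilbertExt

/-! An adjointable operator on `C₀(U)` is multiplication by a bounded continuous function on the
open disc, its `symbol` (`multiplier_apply`, `norm_symbol_le`). Passing to `Q(C₀(U))` forgets
everything but the behaviour of the symbol near the boundary, and a small distance in the quotient
makes two symbols uniformly close there (`exists_norm_symbol_sub_lt`). The Busby invariant of `W_ω`
sends `1` to the class of any `α` equal to `ω` on the boundary, so its symbol has winding number `k`
on all circles of radius close to `1`.

Along a homotopy, the morphism property makes `⟪Δ t 1, Δ t 1⟫ = δ 1` an idempotent. Hence the
modulus of the symbol of `Δ t 1` gets close to `0` or `1` at the boundary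
(`exists_norm_symbol_idempotent`). This gap is what carries the argument: a small move keeps the
modulus above `1/2`, the idempotent forces it back above `3/4`, and a Rouché argument preserves the
winding number (`HasBoundaryWinding.of_near`). The bounds do not deteriorate from one step to the
next, so having boundary winding `k` is a locally constant property of `t`, and connectedness of
`[0,1]` carries it from `W_ω` to `W_ω'`, where the winding number is `k'`. -/

/-! ### Winding numbers of loops in the punctured plane -/

/-- The `2π`-periodic function `γ` has a continuous logarithm which increases by `2πik` along a
period. -/
def IsWinding (γ : ℝ → ℂ) (k : ℤ) : Prop :=
  ∃ θ : ℝ → ℂ, Continuous θ ∧ (∀ s, γ s = Complex.exp (θ s)) ∧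
    θ (2 * Real.pi) - θ 0 = 2 * Real.pi * Complex.I * k

/-- Two continuous logarithms of the same function differ by `2πi` times a continuous integer-valued
function, which is constant on `ℝ`; so they have the same increment. -/
theorem IsWinding.eq {γ : ℝ → ℂ} {k l : ℤ} (hk : IsWinding γ k) (hl : IsWinding γ l) : k = l := by
  obtain ⟨θ, hθ, hγ, hk⟩ := hk
  obtain ⟨η, hη, hγ', hl⟩ := hl
  have hpi : (2 * Real.pi * Complex.I : ℂ) ≠ 0 := Complex.two_pi_I_ne_zero
  have hn (s : ℝ) : ∃ n : ℤ, θ s = η s + n * (2 * Real.pi * Complex.I) :=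
    Complex.exp_eq_exp_iff_exists_int.1 ((hγ s).symm.trans (hγ' s))
  choose n hn using hn
  have hc : Continuous fun s => (n s : ℝ) := by
    have h : (fun s => (n s : ℝ)) =
        fun s => ((θ s - η s) / (2 * Real.pi * Complex.I)).re := by
      ext s
      rw [hn, add_sub_cancel_left, mul_div_cancel_right₀ _ hpi, Complex.intCast_re]
    rw [h]
    fun_prop
  have hn' : Continuous n := Int.isClosedEmbedding_coe_real.isInducing.continuous_iff.2 hc
  have h0 : n (2 * Real.pi) = n 0 := PreconnectedSpace.constant inferInstance hn'
  have h : (k : ℂ) * (2 * Real.pi * Complex.I) = l * (2 * Real.pi * Complex.I) := by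
    have h1 := hn (2 * Real.pi)
    have h2 := hn 0
    rw [h0] at h1
    linear_combination hl - hk + h1 - h2
  exact_mod_cast mul_right_cancel₀ hpi h

/-- Rouché's argument: `g / f` stays in the unit disc around `1`, where the principal logarithm is
continuous. Adding that logarithm to the one of `f` gives a logarithm of `g`, and it contributes no
increment because `g / f` takes the same value at `0` and `2π`. -/
theorem IsWinding.of_norm_sub_lt {f g : ℝ → ℂ} {k : ℤ} (hf : IsWinding f k) (hg : Continuous g)
    (hg' : g (2 * Real.pi) = g 0) (h : ∀ s, ‖g s - f s‖ < ‖f s‖) : IsWinding g k := by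
  obtain ⟨θ, hθ, hfθ, hk⟩ := hf
  have hne (s : ℝ) : f s ≠ 0 := by rw [hfθ]; exact Complex.exp_ne_zero _
  have hfc : Continuous f := by
    rw [funext hfθ]; fun_prop
  have hmem (s : ℝ) : g s / f s ∈ Complex.slitPlane := by
    have h1 : ‖g s / f s - 1‖ < 1 := by
      rw [← div_self (hne s), ← sub_div, norm_div, div_lt_one (norm_pos_iff.2 (hne s))]
      exact h s
    exact Complex.ball_one_subset_slitPlane (mem_ball_iff_norm.2 h1)
  have hf' : f (2 * Real.pi) = f 0 := by
    rw [hfθ, hfθ, Complex.exp_eq_exp_iff_exists_int]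
    exact ⟨k, by linear_combination hk⟩
  refine ⟨fun s => θ s + Complex.log (g s / f s), ?_, fun s => ?_, ?_⟩
  · exact hθ.add ((hg.div hfc hne).clog hmem)
  · rw [Complex.exp_add, ← hfθ, Complex.exp_log (Complex.slitPlane_ne_zero (hmem s)),
      mul_div_cancel₀ _ (hne s)]
  · simp only [hg', hf', add_sub_add_right_eq_sub, hk]

theorem HasWindingNumber.isWinding {ω : C(Circle, Circle)} {k : ℤ} (h : HasWindingNumber ω k) :
    IsWinding (fun s => (ω (Circle.exp s) : ℂ)) k := by
  obtain ⟨θ, hθ, hk⟩ := h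
  refine ⟨fun s => θ s * Complex.I, by fun_prop, fun s => ?_, ?_⟩
  · simp only [hθ, Circle.coe_exp]
  have := congrArg (fun x : ℝ => (x : ℂ)) hk
  push_cast at this
  linear_combination Complex.I * this

/-! ### Circles in the disc -/

/-- The point `r e^{is}` of the disc. -/
def discPoint (r : ℝ) (hr : |r| < 1) (s : ℝ) : Disc :=
  ⟨r * Circle.exp s, by simpa using hr⟩

theorem norm_discPoint (r : ℝ) (hr : |r| < 1) (s : ℝ) : ‖(discPoint r hr s).1‖ = |r| := by
  simp [discPoint]

theorem continuous_discPoint (r : ℝ) (hr : |r| < 1) : Continuous (discPoint r hr) :=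
  Continuous.subtype_mk (by fun_prop) _

theorem discPoint_two_pi (r : ℝ) (hr : |r| < 1) : discPoint r hr (2 * Real.pi) = discPoint r hr 0 :=
  Subtype.ext (by simp [discPoint])

/-- A compact subset of the open disc has a point of largest modulus, which is less than `1`; this
turns vanishing at infinity into a statement about an annulus. -/
theorem exists_norm_lt_of_norm_gt (v : C₀(Disc, ℂ)) {ε : ℝ} (hε : 0 < ε) :
    ∃ r₀ < 1, ∀ z : Disc, r₀ < ‖z.1‖ → ‖v z‖ < ε := by
  have h : ∀ᶠ z in Filter.cocompact Disc, ‖v z‖ < ε := by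
    have := v.zero_at_infty'.norm
    rw [norm_zero] at this
    exact this.eventually (gt_mem_nhds hε)
  obtain ⟨K, hK, hKv⟩ := Filter.mem_cocompact.1 h
  rcases K.eq_empty_or_nonempty with rfl | hne
  -- No maximum exists on the empty set, and any radius below `1` would do.
  · exact ⟨0, one_pos, fun z _ => hKv (by simp)⟩
  · obtain ⟨x, -, hmax⟩ := hK.exists_isMaxOn hne (f := fun z : Disc => ‖z.1‖) (by fun_prop)
    refine ⟨‖x.1‖, mem_ball_zero_iff.1 x.2, fun z hz => hKv fun hzK => ?_⟩
    exact hz.not_ge (hmax hzK)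

/-! ### Multipliers of `C₀(U)` as functions -/

theorem exists_discBump : ∃ f : C₀(Disc, ℂ), ∀ z, f z = 1 - (‖z.1‖ : ℂ) ^ 2 := by
  obtain ⟨f, hf⟩ := exists_extendZero (b := descend bump bump_boundary) (by
    rw [← collapse_boundary 1, descend_collapse, bump_boundary])
  refine ⟨f, fun z => ?_⟩
  have h := DFunLike.congr_fun hf (collapse (interior z))
  rw [descend_collapse, collapse_interior] at h
  exact h

/-- The function `1 - |z|²` on the open disc. -/
def discBump : C₀(Disc, ℂ) := exists_discBump.choose

theorem discBump_apply (z : Disc) : discBump z = 1 - (‖z.1‖ : ℂ) ^ 2 :=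
  exists_discBump.choose_spec z

theorem discBump_ne_zero (z : Disc) : discBump z ≠ 0 := by
  rw [discBump_apply]; exact bump_interior z

/-- The multipliers `C₀(U) → C₀(U)`. -/
abbrev DiscMultiplier : Type := MultiplierModule C₀(Disc, ℂ) C₀(Disc, ℂ)

/-- The bounded continuous function on the disc by which a multiplier acts. -/
def symbol (T : DiscMultiplier) (z : Disc) : ℂ := T.1 discBump z / discBump z

/-- Linearity over `C₀(U)` is forced by the existence of an adjoint. -/
theorem multiplier_mul (T : DiscMultiplier) (a b : C₀(Disc, ℂ)) : T.1 (a * b) = a * T.1 b := by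
  refine ext_inner C₀(Disc, ℂ) fun v => ?_
  rw [adjoint_spec']
  change _ = inner C₀(Disc, ℂ) v (a • T.1 b)
  rw [CStarModule.inner_op_smul_right, adjoint_spec', mul_assoc]

/-- By commutativity `a * T b = T (a * b) = b * T a`. Taking for `b` the nowhere vanishing
`discBump`, one can divide by it pointwise. -/
theorem multiplier_apply (T : DiscMultiplier) (a : C₀(Disc, ℂ)) (z : Disc) :
    T.1 a z = symbol T z * a z := by
  have h := multiplier_mul T a discBump
  rw [mul_comm, multiplier_mul] at h
  have h' := DFunLike.congr_fun h z
  simp only [ZeroAtInftyContinuousMap.mul_apply] at h'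
  have := discBump_ne_zero z
  rw [symbol, div_mul_eq_mul_div, eq_div_iff this]
  linear_combination h'

theorem symbol_eq {T : DiscMultiplier} {z : Disc} {c : ℂ}
    (h : T.1 discBump z = discBump z * c) : symbol T z = c := by
  rw [symbol, h, mul_div_cancel_left₀ _ (discBump_ne_zero z)]

theorem continuous_symbol (T : DiscMultiplier) : Continuous (symbol T) :=
  (map_continuous (T.1 discBump)).div (map_continuous discBump) discBump_ne_zero

theorem symbol_sub (T S : DiscMultiplier) (z : Disc) :
    symbol (T - S) z = symbol T z - symbol S z := by
  simp [symbol, sub_div]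

theorem symbol_Γ (v : C₀(Disc, ℂ)) (z : Disc) :
    symbol (Γ C₀(Disc, ℂ) C₀(Disc, ℂ) v) z = v z :=
  symbol_eq rfl

/-- The function `1 - |z|²`, rescaled to be `1` at `x` and truncated at `1`. Testing an operator on
it bounds the symbol at `x` by the operator norm. -/
theorem exists_peak (x : Disc) : ∃ a : C₀(Disc, ℂ), a x = 1 ∧ ‖a‖ ≤ 1 := by
  have hx : 0 < 1 - ‖x.1‖ ^ 2 := by
    have h : ‖x.1‖ < 1 := mem_ball_zero_iff.1 x.2
    nlinarith [norm_nonneg x.1]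
  have ht : Filter.Tendsto (fun z : Disc => 1 - ‖z.1‖ ^ 2) (Filter.cocompact Disc) (nhds 0) := by
    have h := (Complex.continuous_re.tendsto 0).comp discBump.zero_at_infty'
    refine h.congr fun z => ?_
    change (discBump z).re = _
    rw [discBump_apply]
    norm_cast
  let a : C₀(Disc, ℂ) := ⟨⟨fun z => ((min 1 ((1 - ‖z.1‖ ^ 2) / (1 - ‖x.1‖ ^ 2)) : ℝ) : ℂ),
    by fun_prop⟩, by
      have h := (tendsto_const_nhds (x := (1 : ℝ))).min (ht.div_const (1 - ‖x.1‖ ^ 2))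
      simp only [zero_div, zero_le_one, min_eq_right] at h
      exact (Complex.continuous_ofReal.tendsto 0).comp h⟩
  refine ⟨a, ?_, ?_⟩
  · change ((min 1 ((1 - ‖x.1‖ ^ 2) / (1 - ‖x.1‖ ^ 2)) : ℝ) : ℂ) = 1
    rw [div_self hx.ne', min_self, Complex.ofReal_one]
  · change ‖a.toBCF‖ ≤ 1
    rw [BoundedContinuousFunction.norm_le zero_le_one]
    intro z
    change ‖((min 1 ((1 - ‖z.1‖ ^ 2) / (1 - ‖x.1‖ ^ 2)) : ℝ) : ℂ)‖ ≤ 1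
    have hz : 0 ≤ 1 - ‖z.1‖ ^ 2 := by
      have h : ‖z.1‖ < 1 := mem_ball_zero_iff.1 z.2
      nlinarith [norm_nonneg z.1]
    rw [Complex.norm_real, Real.norm_of_nonneg (le_min zero_le_one (by positivity))]
    exact min_le_left _ _

theorem norm_symbol_le (T : DiscMultiplier) (z : Disc) : ‖symbol T z‖ ≤ ‖T‖ := by
  obtain ⟨a, ha, ha'⟩ := exists_peak z
  have h := multiplier_apply T a z
  rw [ha, mul_one] at h
  rw [← h]
  calc ‖T.1 a z‖ ≤ ‖T.1 a‖ := (T.1 a).toBCF.norm_coe_le_norm z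
    _ ≤ ‖T.1‖ * ‖a‖ := T.1.le_opNorm a
    _ ≤ ‖T.1‖ := mul_le_of_le_one_right (norm_nonneg _) ha'

theorem adjoint_apply (T : DiscMultiplier) (v : C₀(Disc, ℂ)) (z : Disc) :
    adjoint T v z = star (symbol T z) * v z := by
  have h := DFunLike.congr_fun (adjoint_spec T discBump v) z
  change v z * star (T.1 discBump z) = adjoint T v z * star (discBump z) at h
  rw [multiplier_apply, star_mul'] at h
  have h' : star (discBump z) ≠ 0 := star_ne_zero.2 (discBump_ne_zero z)
  refine mul_right_cancel₀ h' ?_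
  rw [← h]; ring

/-! ### Norm and inner product of `Q(C₀(U))` in terms of symbols -/

/-- The quotient `Q(V)` for `V = C₀(U)`. -/
abbrev DiscCorona : Type := CoronaModule C₀(Disc, ℂ) C₀(Disc, ℂ)

theorem exists_norm_symbol_sub_lt {T S : DiscMultiplier} {ε : ℝ}
    (h : ‖(Submodule.Quotient.mk S - Submodule.Quotient.mk T : DiscCorona)‖ < ε) :
    ∃ r₀ < 1, ∀ z : Disc, r₀ < ‖z.1‖ → ‖symbol S z - symbol T z‖ < 2 * ε := by
  -- The difference splits as `m + v` with `‖m‖ < ε` and `v` in `C₀(U)`; each part contributes one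
  -- `ε` near the boundary.
  obtain ⟨m, hm, hmε⟩ := QuotientAddGroup.norm_lt_iff.1 h
  have hm' : (Submodule.Quotient.mk (S - T) : DiscCorona) = Submodule.Quotient.mk m := hm.symm
  obtain ⟨v, hv⟩ := (Submodule.Quotient.eq _).1 hm'
  obtain ⟨r₀, hr₀, hvr⟩ := exists_norm_lt_of_norm_gt v ((norm_nonneg _).trans_lt hmε)
  refine ⟨r₀, hr₀, fun z hz => ?_⟩
  have e := congrArg (fun T => symbol T z) hv
  simp only [symbol_Γ, symbol_sub] at e
  have e' : symbol S z - symbol T z = v z + symbol m z := by rw [e]; ring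
  rw [e']
  linarith [norm_add_le (v z) (symbol m z), hvr z hz, norm_symbol_le m z]

/-- If `⟪T, T⟫` is idempotent modulo `C₀(U)`, then `|f|⁴ - |f|²` vanishes at the boundary for the
symbol `f` of `T`. -/
theorem exists_norm_symbol_idempotent {T : DiscMultiplier}
    (h : inner (CoronaAlgebra C₀(Disc, ℂ)) (Submodule.Quotient.mk T : DiscCorona)
        (Submodule.Quotient.mk T : DiscCorona) *
      inner (CoronaAlgebra C₀(Disc, ℂ)) (Submodule.Quotient.mk T : DiscCorona)
        (Submodule.Quotient.mk T : DiscCorona) =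
      inner (CoronaAlgebra C₀(Disc, ℂ)) (Submodule.Quotient.mk T : DiscCorona)
        (Submodule.Quotient.mk T : DiscCorona)) {ε : ℝ} (hε : 0 < ε) :
    ∃ r₀ < 1, ∀ z : Disc, r₀ < ‖z.1‖ →
      |(‖symbol T z‖ ^ 2) ^ 2 - ‖symbol T z‖ ^ 2| < ε := by
  rw [corona_inner_mk, ← map_mul, Ideal.Quotient.eq] at h
  obtain ⟨a, ha⟩ := h
  obtain ⟨r₀, hr₀, har⟩ := exists_norm_lt_of_norm_gt a hε
  refine ⟨r₀, hr₀, fun z hz => ?_⟩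
  -- Both sides are multiplication operators, so evaluating them on `discBump` and cancelling it
  -- identifies `|f|⁴ - |f|²` with `a`.
  have e := congrArg (fun m : 𝓜(ℂ, C₀(Disc, ℂ)) => m.snd discBump z) ha
  simp only [DoubleCentralizer.sub_snd, DoubleCentralizer.mul_snd, DoubleCentralizer.coe_snd] at e
  change adjoint T (T.1 (adjoint T (T.1 discBump))) z - adjoint T (T.1 discBump) z =
    discBump z * a z at e
  simp only [adjoint_apply, multiplier_apply] at e
  have hs : star (symbol T z) * symbol T z = ((‖symbol T z‖ ^ 2 : ℝ) : ℂ) := by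
    rw [Complex.star_def, Complex.conj_mul']; push_cast; rfl
  have e' : (((‖symbol T z‖ ^ 2) ^ 2 - ‖symbol T z‖ ^ 2 : ℝ) : ℂ) = a z := by
    refine mul_left_cancel₀ (discBump_ne_zero z) ?_
    rw [← e, Complex.ofReal_sub, Complex.ofReal_pow _ 2, ← hs]
    ring
  have := har z hz
  rwa [← e', Complex.norm_real, Real.norm_eq_abs] at this

/-! ### Winding numbers of multipliers -/

/-- Near the boundary of the disc, the symbol of `T` is bounded away from zero and has winding
number `k` on every circle around the origin. -/
def HasBoundaryWinding (T : DiscMultiplier) (k : ℤ) : Prop :=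
  ∃ r₀ < 1, ∀ r (hr : |r| < 1), r₀ < r →
    (∀ s, 3 / 4 < ‖symbol T (discPoint r hr s)‖) ∧
      IsWinding (fun s => symbol T (discPoint r hr s)) k

theorem HasBoundaryWinding.eq {T : DiscMultiplier} {k l : ℤ} (hk : HasBoundaryWinding T k)
    (hl : HasBoundaryWinding T l) : k = l := by
  obtain ⟨r₁, h₁, hk⟩ := hk
  obtain ⟨r₂, h₂, hl⟩ := hl
  -- The extra maximum with `0` makes `r` positive, so that `r < 1` yields `|r| < 1`.
  obtain ⟨r, hr, hr'⟩ := exists_between (max_lt (max_lt h₁ h₂) (zero_lt_one (α := ℝ)))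
  have h0 : |r| = r := abs_of_pos ((le_max_right _ _).trans_lt hr)
  have h3 : max r₁ r₂ < r := (le_max_left _ _).trans_lt hr
  exact (hk r (h0.symm ▸ hr') ((le_max_left _ _).trans_lt h3)).2.eq
    (hl r (h0.symm ▸ hr') ((le_max_right _ _).trans_lt h3)).2

/-- Distance `1/8` in the quotient means distance `1/4` between symbols near the boundary. This is
less than the lower bound `3/4` for `T`, so Rouché applies; the idempotent then restores the bound
`3/4` for `S`. -/
theorem HasBoundaryWinding.of_near {T S : DiscMultiplier} {k : ℤ} (hT : HasBoundaryWinding T k)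
    (hTS : ‖(Submodule.Quotient.mk S - Submodule.Quotient.mk T : DiscCorona)‖ < 1 / 8)
    (hS : inner (CoronaAlgebra C₀(Disc, ℂ)) (Submodule.Quotient.mk S : DiscCorona)
        (Submodule.Quotient.mk S : DiscCorona) *
      inner (CoronaAlgebra C₀(Disc, ℂ)) (Submodule.Quotient.mk S : DiscCorona)
        (Submodule.Quotient.mk S : DiscCorona) =
      inner (CoronaAlgebra C₀(Disc, ℂ)) (Submodule.Quotient.mk S : DiscCorona)
        (Submodule.Quotient.mk S : DiscCorona)) : HasBoundaryWinding S k := by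
  obtain ⟨r₁, h₁, hT⟩ := hT
  obtain ⟨r₂, h₂, hd⟩ := exists_norm_symbol_sub_lt hTS
  obtain ⟨r₃, h₃, hp⟩ := exists_norm_symbol_idempotent hS (ε := 1 / 16) (by norm_num)
  refine ⟨max r₁ (max r₂ r₃), max_lt h₁ (max_lt h₂ h₃), fun r hr hr' => ?_⟩
  obtain ⟨hr1, hr2, hr3⟩ : r₁ < r ∧ r₂ < r ∧ r₃ < r := by simpa using hr'
  obtain ⟨hTn, hTw⟩ := hT r hr hr1
  have hd' (s : ℝ) := hd (discPoint r hr s) (by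
    rw [norm_discPoint]; exact hr2.trans_le (le_abs_self r))
  have hp' (s : ℝ) := hp (discPoint r hr s) (by
    rw [norm_discPoint]; exact hr3.trans_le (le_abs_self r))
  refine ⟨fun s => ?_, hTw.of_norm_sub_lt
    ((continuous_symbol S).comp (continuous_discPoint r hr)) (by rw [discPoint_two_pi])
    fun s => by linarith [hd' s, hTn s]⟩
  have h1 := hd' s
  have h2 := (abs_lt.1 (hp' s)).1
  have h3 := hTn s
  have h4 := norm_sub_norm_le (symbol T (discPoint r hr s)) (symbol S (discPoint r hr s))
  rw [norm_sub_rev] at h4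
  set x := ‖symbol S (discPoint r hr s)‖
  -- For `1/2 < x ≤ 3/4` the number `x² - x⁴` exceeds `1/16`, so the idempotent condition excludes
  -- this range.
  have h5 : 1 / 2 < x := by linarith
  by_contra hx
  push Not at hx
  have h6 : 1 / 4 < x ^ 2 := by nlinarith
  have h7 : x ^ 2 ≤ 9 / 16 := by nlinarith
  nlinarith

/-! ### Symbols of the extensions of the disc -/

theorem symbol_Λ {ω : C(Circle, Circle)} (α : WindingModule ω) (z : Disc) :
    symbol ((windingExtension ω).Λ α) z = α.1 (interior z) := by
  refine symbol_eq ?_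
  have h := congrArg (fun β : WindingModule ω => β.1 (interior z))
    ((windingExtension ω).Φ_Λ α discBump)
  change extendZero _ (collapse (interior z)) =
    extendZero discBump (collapse (interior z)) * α.1 (interior z) at h
  simpa using h

/-- By uniform continuity on the closed disc, `α` on a circle of radius near `1` is within `1/4` of
the unimodular `ω`. -/
theorem hasBoundaryWinding_Λ {ω : C(Circle, Circle)} {k : ℤ} (hω : HasWindingNumber ω k)
    {α : WindingModule ω} (hα : (windingExtension ω).Ψ α = 1) :
    HasBoundaryWinding ((windingExtension ω).Λ α) k := by
  have hb (w : Circle) : α.1 (boundary w) = ω w := by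
    rw [boundaryCoeff_spec]
    change (windingExtension ω).Ψ α * _ = _
    rw [hα, one_mul]
  obtain ⟨δ, hδ, hαδ⟩ := Metric.uniformContinuous_iff.1
    (CompactSpace.uniformContinuous_of_continuous α.1.continuous) (1 / 4) (by norm_num)
  refine ⟨1 - δ, by linarith, fun r hr hr' => ?_⟩
  have hclose (s : ℝ) :
      ‖symbol ((windingExtension ω).Λ α) (discPoint r hr s) - ω (Circle.exp s)‖ < 1 / 4 := by
    rw [symbol_Λ, ← hb, ← dist_eq_norm]
    refine hαδ ?_
    have e : (r * (Circle.exp s : ℂ) - Circle.exp s) = ((r - 1 : ℝ) : ℂ) * Circle.exp s := by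
      push_cast; ring
    change dist (r * (Circle.exp s : ℂ)) (Circle.exp s : ℂ) < δ
    rw [dist_eq_norm, e, norm_mul, Circle.norm_coe, mul_one, Complex.norm_real, Real.norm_eq_abs,
      abs_sub_comm, abs_of_pos (by linarith [(abs_lt.1 hr).2])]
    linarith
  refine ⟨fun s => ?_, hω.isWinding.of_norm_sub_lt
    ((continuous_symbol _).comp (continuous_discPoint r hr)) (by rw [discPoint_two_pi])
    fun s => (hclose s).trans (by rw [Circle.norm_coe]; norm_num)⟩
  have h1 := norm_sub_norm_le (ω (Circle.exp s) : ℂ)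
    (symbol ((windingExtension ω).Λ α) (discPoint r hr s))
  rw [norm_sub_rev, Circle.norm_coe] at h1
  linarith [hclose s]

end HilbertExt
end
-- Invariance of the winding number along a homotopy
open HilbertExt in
theorem mainTheorem6 (ω ω' : C(Circle, Circle)) (k k' : ℤ) (hω : HasWindingNumber ω k)
    (hω' : HasWindingNumber ω' k') (hkk' : k ≠ k') :
    ¬ (windingExtension ω).Homotopic (windingExtension ω') := by
  rintro ⟨Δ, hΔ, h0, h1, hc⟩
  -- `1` is idempotent in `ℂ` and `δ` is multiplicative; `δ` need not be unital, so only an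
  -- idempotent is obtained.
  have hp (t : unitInterval) : inner (CoronaAlgebra C₀(Disc, ℂ)) (Δ t 1) (Δ t 1) *
      inner (CoronaAlgebra C₀(Disc, ℂ)) (Δ t 1) (Δ t 1) =
      inner (CoronaAlgebra C₀(Disc, ℂ)) (Δ t 1) (Δ t 1) := by
    obtain ⟨δ, hδ⟩ := hΔ t
    rw [hδ 1 1, ← map_mul]
    congr 1
    simp
  -- Continuity restated for the topology of the quotient norm, so that balls can be used as
  -- neighbourhoods.
  have hc' : @Continuous _ _ _ PseudoMetricSpace.toUniformSpace.toTopologicalSpace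
    fun t => (Δ t 1 : DiscCorona) := hc 1
  have hstep {t s : unitInterval} (hts : ‖(Δ s 1 - Δ t 1 : DiscCorona)‖ < 1 / 8)
      (h : ∃ T, Submodule.Quotient.mk T = Δ t 1 ∧ HasBoundaryWinding T k) (S : DiscMultiplier)
      (hS : Submodule.Quotient.mk S = Δ s 1) : HasBoundaryWinding S k := by
    obtain ⟨T, hT, hTk⟩ := h
    rw [← hS, ← hT] at hts
    refine hTk.of_near hts ?_
    rw [hS]
    exact hp s
  have hloc : IsLocallyConstant fun t : unitInterval =>
      ∃ T, Submodule.Quotient.mk T = Δ t 1 ∧ HasBoundaryWinding T k := by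
    rw [IsLocallyConstant.iff_eventually_eq]
    intro t
    have ht := hc'.tendsto t
    filter_upwards [ht.eventually (Metric.ball_mem_nhds _ (ε := 1 / 8) (by norm_num))] with s hs
    have hs' : ‖(Δ s 1 - Δ t 1 : DiscCorona)‖ < 1 / 8 := mem_ball_iff_norm.1 hs
    refine propext ⟨fun h => ?_, fun h => ?_⟩
    · obtain ⟨T, hT⟩ := Submodule.Quotient.mk_surjective _ (Δ t 1)
      exact ⟨T, hT, hstep ((norm_sub_rev (Δ t 1 : DiscCorona) (Δ s 1)).trans_lt hs') h T hT⟩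
    · obtain ⟨T, hT⟩ := Submodule.Quotient.mk_surjective _ (Δ s 1)
      exact ⟨T, hT, hstep hs' h T hT⟩
  obtain ⟨α, hα⟩ := (windingExtension ω).surjective 1
  obtain ⟨β, hβ⟩ := (windingExtension ω').surjective 1
  have hα' : Submodule.Quotient.mk ((windingExtension ω).Λ α) = Δ 0 1 := by
    rw [h0, ← (windingExtension ω).busby_Ψ, hα]
  have hβ' : Submodule.Quotient.mk ((windingExtension ω').Λ β) = Δ 1 1 := by
    rw [h1, ← (windingExtension ω').busby_Ψ, hβ]
  have hk := (hloc.apply_eq_of_preconnectedSpace 0 1).mp ⟨_, hα', hasBoundaryWinding_Λ hω hα⟩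
  -- A step of length zero at `t = 1` passes from the unspecified representative in `hk` to `Λ β`.
  have hk1 := hstep (by
    rw [sub_self]
    exact (norm_zero (E := DiscCorona)).trans_lt (by norm_num)) hk _ hβ'
  exact hkk' (hk1.eq (hasBoundaryWinding_Λ hω' hβ))
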